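/- **Setting.** Fix integers $m\ge 2$, $r\ge 2$ and a real $c_0>0$. For each $n$ let $[n]$ be the vertex set and add a null vertex $n+1$. An index $(i_1,\dots,i_m)\in[n+1]^m$ is called an *edge index* if, after all copies of $n+1$ are removed, the multiset $\{\{i_1,\dots,i_m\}\}$ is a non-empty set; let $I_n$ be the set of non-decreasing edge indices, which correspond one to one to the $\varphi(n,m)=\sum_{k=1}^m\binom nk$ potential hyperedges, i.e. the non-empty subsets of $[n]$ with at most $m$ elements. An *embedding* is an $(n+1)\times r$ real matrix $\alpha$ with rows $\alpha_i$ such that $\alpha_{n+1}=(1,\dots,1)$ and $\|\alpha_i\|_2\le c_0$ for $i\in[n]$; its tensor is $\Theta(\alpha)=\mathcal I\times_1\alpha\times_2\cdots\times_m\alpha$, where $\mathcal I$ is the identity tensor, i.e. $\theta_{i_1\dots i_m}=\sum_{q=1}^r\prod_{k=1}^m\alpha_{i_kq}$. Let $s_n\in(0,1]$, let $\alpha^*=\alpha^*_n$ be an embedding and $\Theta^*=\Theta(\alpha^*)$. Observe a random hypergraph on $[n]$ with hyperedges of at most $m$ vertices, in which the potential hyperedges appear independently, the one of index $(i_1,\dots,i_m)\in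 I_n$ with probability $s_n(1+e^{-\theta^*_{i_1\dots i_m}})^{-1}$; $a_{i_1\dots i_m}\in\{0,1\}$ indicates whether it is present. For $\lambda_{0n},\lambda_{1n}>0$ and $K=K_n\ge 1$ put $$L(\theta;a)=\log\Big(1+\tfrac{s_n}{1-s_n+e^{-\theta}}\Big)-a\log\Big(\tfrac{s_n}{1-s_n+e^{-\theta}}\Big),\qquad J_\lambda(\alpha)=\tfrac{\lambda_{0n}}n\|\alpha\|_F^2+\lambda_{1n}\min_{Z,C}\tfrac1n\|\alpha-ZC\|_F^2,$$ where $C$ runs over $\mathbb R^{(K+1)\times r}$ and $Z\in\{0,1\}^{(n+1)\times(K+1)}$ over the community membership matrices (each vertex of $[n]$ is in exactly one of the classes $1,\dots,K$, and the null vertex alone is in class $K+1$). Let $\hat\alpha$ minimize $\varphi(n,m)^{-1}\sum_{I_n}L(\theta_{i_1\dots i_m}(\alpha);a_{i_1\dots i_m})+J_\lambda(\alpha)$ over all embeddings $\alpha$, and let $\widehat\Theta=\Theta(\hat\alpha)$. With $p=s_n(1+e^{-\theta})^{-1}$ and $p'=s_n(1+e^{-\theta'})^{-1}$ let $d^2(\theta,\theta')=(\sqrt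 p-\sqrt{p'})^2+(\sqrt{1-p}-\sqrt{1-p'})^2$, and let $D^2(\Theta,\Theta')=\varphi(n,m)^{-1}\sum_{I_n}d^2(\theta_{i_1\dots i_m},\theta'_{i_1\dots i_m})$ be the averaged squared Hellinger distance. **Theorem 1.** There is a constant $c_1>0$, depending only on $m,r,c_0$, such that the following holds. Suppose that $\epsilon_n>0$, $J_\lambda(\alpha^*)<\frac12\epsilon_n$ for all $n$, and $n\,\varphi(n,m)^{-1}\epsilon_n^{-1}\log\epsilon_n^{-1/2}\to0$ as $n\to\infty$. Then, for all sufficiently large $n$, $$P\big(D^2(\widehat\Theta,\Theta^*)\ge\epsilon_n\big)\le4\exp\big(-c_1\varphi(n,m)\epsilon_n\big).$$ Moreover $D^2(\widehat\Theta,\Theta^*)=O_p(\epsilon_n)$ and $n^{-m/2}\|\widehat\Theta-\Theta^*\|_F=O_p(\sqrt{\epsilon_n/s_n})$, where the Frobenius norm is taken over the edge indices (in any order); if $1/n=O(\epsilon_n/s_n)$, then the last bound also holds with the Frobenius norm over all of $[n+1]^m$. -/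

import Mathlib

open MeasureTheory ProbabilityTheory Filter Topology Asymptotics

noncomputable section

namespace HEM

/-- An `m`th-order cubical real tensor of dimension `N`. -/
abbrev Tensor (m N : ℕ) : Type := (Fin m → Fin N) → ℝ

/-- The identity tensor: `1` when all indices agree, `0` otherwise. -/
def identityTensor (m r : ℕ) : Tensor m r :=
  open Classical in fun j => if ∀ k l, j k = j l then 1 else 0

/-- The tensor `A ×₁ M ×₂ ⋯ ×ₘ M`. -/
def modeProduct {m r N : ℕ} (A : Tensor m r) (M : Matrix (Fin N) (Fin r) ℝ) : Tensor m N :=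
  fun i => ∑ j : Fin m → Fin r, A j * ∏ k, M (i k) (j k)

/-- Frobenius norm of a tensor. -/
def Tensor.frobenius {m N : ℕ} (T : Tensor m N) : ℝ := √(∑ i, T i ^ 2)

/-- Squared Frobenius norm of a matrix. -/
def frobeniusSq {N r : ℕ} (M : Matrix (Fin N) (Fin r) ℝ) : ℝ := ∑ i, ∑ j, M i j ^ 2

/-! The vertices are `Fin n`, seen in `Fin (n + 1)` through `Fin.castSucc`; the null vertex is
`Fin.last n`. -/

/-- `δ^{n+1}_{i₁…iₘ} = 0`: after removing the null vertex, the multiset `{{i₁, …, iₘ}}` is a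
non-empty set. -/
def IsEdgeIndex {m n : ℕ} (i : Fin m → Fin (n + 1)) : Prop :=
  (∃ k, i k ≠ Fin.last n) ∧ ∀ k l, i k ≠ Fin.last n → i k = i l → k = l

/-- The indices with `δ^{n+1,ord}_{i₁…iₘ} = 0`; there is one for each potential hyperedge. -/
def edgeIndices (m n : ℕ) : Finset (Fin m → Fin (n + 1)) :=
  open Classical in Finset.univ.filter fun i => IsEdgeIndex i ∧ Monotone i

/-- The number of potential hyperedges, `φ(n,m) = ∑_{k=1}^m (n choose k)`. -/
def numEdges (n m : ℕ) : ℕ := ∑ k ∈ Finset.Icc 1 m, n.choose k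

/-- The set of (non-null) vertices that occur in an index. -/
def vertices {m n : ℕ} (i : Fin m → Fin (n + 1)) : Finset (Fin n) :=
  open Classical in Finset.univ.filter fun v => ∃ k, i k = v.castSucc

/-- Adjacency tensor of the hypergraph on `Fin n` with hyperedge set `E`. -/
def adjacency (m : ℕ) {n : ℕ} (E : Finset (Finset (Fin n))) : Tensor m (n + 1) :=
  open Classical in fun i => if IsEdgeIndex i ∧ vertices i ∈ E then 1 else 0

/-- The part of a tensor that sits on the potential hyperedges (`δ^{n+1} = 0`). -/
def edgePart {m n : ℕ} (T : Tensor m (n + 1)) : Tensor m (n + 1) :=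
  open Classical in fun i => if IsEdgeIndex i then T i else 0

/-- The tensor `Θ = I ×₁ α ×₂ ⋯ ×ₘ α` of an embedding matrix `α`. -/
def embTensor (m : ℕ) {n r : ℕ} (α : Matrix (Fin (n + 1)) (Fin r) ℝ) : Tensor m (n + 1) :=
  modeProduct (identityTensor m r) α

/-- Entrywise, the tensor of an embedding is its symmetric CP decomposition. -/
theorem embTensor_apply {m n r : ℕ} (hm : 0 < m) (α : Matrix (Fin (n + 1)) (Fin r) ℝ)
    (i : Fin m → Fin (n + 1)) : embTensor m α i = ∑ q, ∏ k, α (i k) q := by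
  classical
  have : Nonempty (Fin m) := ⟨⟨0, hm⟩⟩
  symm
  unfold embTensor modeProduct identityTensor
  simp only [ite_mul, one_mul, zero_mul]
  rw [← Finset.sum_filter]
  refine Finset.sum_bij (fun q _ => fun _ => q) (by simp) ?_ ?_ (by simp)
  · intro a _ b _ h
    exact congrFun h ⟨0, hm⟩
  · intro j hj
    refine ⟨j ⟨0, hm⟩, Finset.mem_univ _, funext fun k => ?_⟩
    exact (Finset.mem_filter.mp hj).2 _ _

/-- Admissible embeddings: the null vertex sits at the all-ones vector, and every vertex has
Euclidean norm at most `c₀`. -/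
def IsEmbedding (c₀ : ℝ) {n r : ℕ} (α : Matrix (Fin (n + 1)) (Fin r) ℝ) : Prop :=
  (∀ q, α (Fin.last n) q = 1) ∧ ∀ v : Fin n, ‖WithLp.toLp 2 (α v.castSucc)‖ ≤ c₀

/-- Hyperedge probability `p = s (1 + e^{-θ})⁻¹` with sparsity factor `s`. -/
def edgeProb (s θ : ℝ) : ℝ := s * (1 + Real.exp (-θ))⁻¹

/-- The hypergraph embedding model: a random hypergraph with hyperedges of cardinality at most
`m`, in which the potential hyperedges appear independently, each with its probability
`s (1 + e^{-θ})⁻¹`. -/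
structure IsModel {m n : ℕ} (s : ℝ) (Θ : Tensor m (n + 1)) {Ω : Type*} [MeasurableSpace Ω]
    (μ : Measure Ω) (E : Ω → Finset (Finset (Fin n))) : Prop where
  range_le : ∀ ω, ∀ e ∈ E ω, e.Nonempty ∧ e.card ≤ m
  measurableSet : ∀ i ∈ edgeIndices m n, MeasurableSet {ω | vertices i ∈ E ω}
  indep : iIndepSet (fun i : edgeIndices m n => {ω | vertices i.1 ∈ E ω}) μ
  prob : ∀ i ∈ edgeIndices m n, μ.real {ω | vertices i ∈ E ω} = edgeProb s (Θ i)

/-- Negative log-likelihood of one entry. -/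
def entryLoss (s θ a : ℝ) : ℝ :=
  Real.log (1 + s / (1 - s + Real.exp (-θ))) - a * Real.log (s / (1 - s + Real.exp (-θ)))

/-- Averaged negative log-likelihood. -/
def negLogLik {m n : ℕ} (s : ℝ) (Θ A : Tensor m (n + 1)) : ℝ :=
  (numEdges n m : ℝ)⁻¹ * ∑ i ∈ edgeIndices m n, entryLoss s (Θ i) (A i)

/-- Community membership matrix of `ψ : [n] → [K]`; the null vertex is alone in the extra
class. -/
def membership {n K : ℕ} (ψ : Fin n → Fin K) : Matrix (Fin (n + 1)) (Fin (K + 1)) ℝ :=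
  fun i j =>
    if j = Fin.lastCases (motive := fun _ => Fin (K + 1)) (Fin.last K)
      (fun v => (ψ v).castSucc) i then 1 else 0

/-- First penalty. -/
def J₀ {n r : ℕ} (α : Matrix (Fin (n + 1)) (Fin r) ℝ) : ℝ := 1 / (n : ℝ) * frobeniusSq α

/-- Second penalty, with `K` communities. -/
def J₁ (K : ℕ) {n r : ℕ} (α : Matrix (Fin (n + 1)) (Fin r) ℝ) : ℝ :=
  ⨅ p : (Fin n → Fin K) × Matrix (Fin (K + 1)) (Fin r) ℝ,
    1 / (n : ℝ) * frobeniusSq (α - membership p.1 * p.2)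

/-- Total penalty. -/
def penalty (K : ℕ) (l₀ l₁ : ℝ) {n r : ℕ} (α : Matrix (Fin (n + 1)) (Fin r) ℝ) : ℝ :=
  l₀ * J₀ α + l₁ * J₁ K α

/-- The penalized objective. -/
def objective (m K : ℕ) (s l₀ l₁ : ℝ) {n r : ℕ} (A : Tensor m (n + 1))
    (α : Matrix (Fin (n + 1)) (Fin r) ℝ) : ℝ :=
  negLogLik s (embTensor m α) A + penalty K l₀ l₁ α

/-- `αh` minimizes the penalized objective over all admissible embeddings. -/
def IsEstimate (m K : ℕ) (c₀ s l₀ l₁ : ℝ) {n r : ℕ} (A : Tensor m (n + 1))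
    (αh : Matrix (Fin (n + 1)) (Fin r) ℝ) : Prop :=
  IsEmbedding c₀ αh ∧
    ∀ α : Matrix (Fin (n + 1)) (Fin r) ℝ, IsEmbedding c₀ α →
      objective m K s l₀ l₁ A αh ≤ objective m K s l₀ l₁ A α

/-- Hellinger distance of the two Bernoulli distributions given by `θ` and `θ'`. -/
def hellinger (s θ θ' : ℝ) : ℝ :=
  √((√(edgeProb s θ) - √(edgeProb s θ')) ^ 2 +
    (√(1 - edgeProb s θ) - √(1 - edgeProb s θ')) ^ 2)

/-- Averaged squared Hellinger distance `D²` over the potential hyperedges. -/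
def avgHellingerSq {m n : ℕ} (s : ℝ) (Θ Θ' : Tensor m (n + 1)) : ℝ :=
  (numEdges n m : ℝ)⁻¹ * ∑ i ∈ edgeIndices m n, hellinger s (Θ i) (Θ' i) ^ 2

/-- `X_n = O_p(a_n)`, where `X_n` lives on its own probability space. -/
def IsBigOp {Ω : ℕ → Type*} [∀ n, MeasurableSpace (Ω n)] (μ : ∀ n, Measure (Ω n))
    (X : ∀ n, Ω n → ℝ) (a : ℕ → ℝ) : Prop :=
  ∀ δ : ℝ, 0 < δ → ∃ M : ℝ, 0 < M ∧
    ∀ᶠ n in atTop, (μ n).real {ω | M * a n < |X n ω|} ≤ δ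

end HEM

end

/-!
The minus log-likelihood of one entry, `-log p` or `-log (1 - p)` with `p = s (1 + e^{-θ})⁻¹`, is
`1`-Lipschitz in the natural parameter `θ`, whatever the sparsity factor `s`
(`entryLoss_le_add`). A net of embeddings for the supremum norm is therefore fine enough to control
the likelihood uniformly, and no chaining in the Hellinger metric is needed.

For a fixed tensor `Θ` the mean of the square root of the likelihood ratio against `Θ*` is the
product of the Hellinger affinities `1 - d² / 2`, hence at most `exp (-φ D² / 2)`, and Markov's
inequality bounds the probability that the log-likelihood ratio exceeds `-t`
(`measure_logLikRatio_ge_le`). By minimality and `J_λ(α*) < ε / 2`, the estimate has log-likelihood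
ratio at least `-φ ε / 2`. Cutting the embeddings into the cells of a cubic grid of width
proportional to `ε`, and representing each cell by one of its embeddings with `D² ≥ ε`, if there is
one, costs a further `φ ε / 4`; the union bound over the `(C / ε)^{nr}` cells gives
`P (D² ≥ ε) ≤ (C / ε)^{nr} exp (-φ ε / 8)` (`measure_avgHellingerSq_ge_le`). The growth condition
absorbs the number of cells into the exponential (`eventually_entropy_le`), which leaves
`exp (-φ ε / 16)`; the case `ε ≥ 2` is void because `D² < 2`.

For the Frobenius norms, the natural parameters are bounded in terms of `m`, `r`, `c₀`, and there
`d²` is at least a constant times `s (θ - θ')²` (`hellingerConst_mul_le`). The tensors are symmetric,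
so that the sum over all edge indices is at most `m!` times that over the monotone ones. An index
that is no edge index repeats an entry, so there are `O(n^{m-1})` of them, which contribute `O(1/n)`
to the normalized squared norm.
-/

namespace HEM

/-! ### Entrywise losses and Hellinger distances -/

theorem edgeProb_pos {s : ℝ} (hs : 0 < s) (θ : ℝ) : 0 < edgeProb s θ := by
  unfold edgeProb; positivity

theorem one_sub_edgeProb (s θ : ℝ) :
    1 - edgeProb s θ = (1 - s + Real.exp (-θ)) / (1 + Real.exp (-θ)) := by
  have : 0 < 1 + Real.exp (-θ) := by positivity
  unfold edgeProb
  field_simp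
  ring

theorem one_sub_edgeProb_pos {s : ℝ} (hs : s ≤ 1) (θ : ℝ) : 0 < 1 - edgeProb s θ := by
  rw [one_sub_edgeProb]
  have := Real.exp_pos (-θ)
  have : 0 < 1 - s + Real.exp (-θ) := by linarith
  positivity

theorem edgeProb_div {s : ℝ} (hs : s ≤ 1) (θ : ℝ) :
    s / (1 - s + Real.exp (-θ)) = edgeProb s θ / (1 - edgeProb s θ) := by
  rw [one_sub_edgeProb]
  have := Real.exp_pos (-θ)
  have : 0 < 1 - s + Real.exp (-θ) := by linarith
  have : 0 < 1 + Real.exp (-θ) := by positivity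
  unfold edgeProb
  field_simp

theorem entryLoss_zero {s : ℝ} (hs : s ≤ 1) (θ : ℝ) :
    entryLoss s θ 0 = -Real.log (1 - edgeProb s θ) := by
  have h := one_sub_edgeProb_pos hs θ
  rw [entryLoss, edgeProb_div hs, zero_mul, sub_zero, ← Real.log_inv]
  congr 1
  field_simp
  ring

theorem entryLoss_one {s : ℝ} (hs₀ : 0 < s) (hs : s ≤ 1) (θ : ℝ) :
    entryLoss s θ 1 = -Real.log (edgeProb s θ) := by
  have h := one_sub_edgeProb_pos hs θ
  have h' := edgeProb_pos hs₀ θ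
  have := entryLoss_zero hs θ
  rw [entryLoss, zero_mul, sub_zero] at this
  rw [entryLoss, this, edgeProb_div hs, Real.log_div h'.ne' h.ne']
  ring

/-- The entrywise loss is `1`-Lipschitz in the natural parameter, whatever the sparsity factor. -/
theorem entryLoss_le_add {s : ℝ} (hs₀ : 0 < s) (hs : s ≤ 1) (θ θ' : ℝ) {a : ℝ}
    (ha : a = 0 ∨ a = 1) : entryLoss s θ a ≤ entryLoss s θ' a + |θ - θ'| := by
  have hp := edgeProb_pos hs₀ θ
  have hp' := edgeProb_pos hs₀ θ'
  have hq := one_sub_edgeProb_pos hs θ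
  have hq' := one_sub_edgeProb_pos hs θ'
  have hx := Real.exp_pos (-θ)
  have hx' := Real.exp_pos (-θ')
  have hk : 1 ≤ Real.exp |θ - θ'| := Real.one_le_exp (abs_nonneg _)
  have h1 : Real.exp (-θ) ≤ Real.exp |θ - θ'| * Real.exp (-θ') := by
    rw [← Real.exp_add]
    exact Real.exp_le_exp.mpr (by linarith [neg_abs_le (θ - θ')])
  have h2 : Real.exp (-θ') ≤ Real.exp |θ - θ'| * Real.exp (-θ) := by
    rw [← Real.exp_add]
    exact Real.exp_le_exp.mpr (by linarith [le_abs_self (θ - θ')])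
  rcases ha with rfl | rfl
  · rw [entryLoss_zero hs, entryLoss_zero hs]
    suffices h : Real.log (1 - edgeProb s θ') ≤
        Real.log (Real.exp |θ - θ'| * (1 - edgeProb s θ)) by
      rw [Real.log_mul (Real.exp_pos _).ne' hq.ne', Real.log_exp] at h
      linarith
    refine Real.log_le_log hq' ?_
    rw [one_sub_edgeProb, one_sub_edgeProb, ← mul_div_assoc, div_le_div_iff₀ (by positivity)
      (by positivity)]
    generalize Real.exp (-θ) = x at *
    generalize Real.exp (-θ') = x' at *
    generalize Real.exp |θ - θ'| = k at *
    have e1 : (1 - s + x') ≤ k * (1 - s + x) := by nlinarith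
    nlinarith [mul_nonneg (sub_nonneg.2 e1) hs₀.le, mul_pos hx hx',
      mul_nonneg (sub_nonneg.2 hk) (mul_nonneg (by linarith : 0 ≤ 1 - s + x)
        (by linarith : 0 ≤ 1 - s + x'))]
  · rw [entryLoss_one hs₀ hs, entryLoss_one hs₀ hs]
    suffices h : Real.log (edgeProb s θ') ≤ Real.log (Real.exp |θ - θ'| * edgeProb s θ) by
      rw [Real.log_mul (Real.exp_pos _).ne' hp.ne', Real.log_exp] at h
      linarith
    refine Real.log_le_log hp' ?_
    unfold edgeProb
    rw [← div_eq_mul_inv, ← div_eq_mul_inv, ← mul_div_assoc, div_le_div_iff₀ (by positivity)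
      (by positivity)]
    nlinarith

/-- The squared Hellinger distance in terms of the Hellinger affinity. -/
theorem hellinger_sq {s : ℝ} (hs₀ : 0 < s) (hs : s ≤ 1) (θ θ' : ℝ) :
    hellinger s θ θ' ^ 2 = 2 - 2 * (√(edgeProb s θ) * √(edgeProb s θ') +
      √(1 - edgeProb s θ) * √(1 - edgeProb s θ')) := by
  rw [hellinger, Real.sq_sqrt (by positivity)]
  have h1 := Real.sq_sqrt (edgeProb_pos hs₀ θ).le
  have h2 := Real.sq_sqrt (edgeProb_pos hs₀ θ').le
  have h3 := Real.sq_sqrt (one_sub_edgeProb_pos hs θ).le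
  have h4 := Real.sq_sqrt (one_sub_edgeProb_pos hs θ').le
  linear_combination h1 + h2 + h3 + h4

theorem hellinger_sq_lt_two {s : ℝ} (hs₀ : 0 < s) (hs : s ≤ 1) (θ θ' : ℝ) :
    hellinger s θ θ' ^ 2 < 2 := by
  rw [hellinger_sq hs₀ hs]
  have h1 := Real.sqrt_pos.2 (edgeProb_pos hs₀ θ)
  have h2 := Real.sqrt_pos.2 (edgeProb_pos hs₀ θ')
  have := mul_pos h1 h2
  have : 0 ≤ √(1 - edgeProb s θ) * √(1 - edgeProb s θ') := by positivity
  linarith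

/-- A constant `c` for which `s c (θ - θ')²` is at most the squared Hellinger distance, for natural
parameters in `[-M, M]`. -/
noncomputable def hellingerConst (M : ℝ) : ℝ := (Real.exp (-M) / (2 * (1 + Real.exp M) ^ 2)) ^ 2

theorem hellingerConst_pos (M : ℝ) : 0 < hellingerConst M := by
  unfold hellingerConst; positivity

theorem exp_neg_mul_abs_sub_le {M θ θ' : ℝ} (hθ : |θ| ≤ M) (hθ' : |θ'| ≤ M) :
    Real.exp (-M) * |θ - θ'| ≤ |Real.exp (-θ') - Real.exp (-θ)| := by
  wlog h : θ' ≤ θ generalizing θ θ'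
  · rw [abs_sub_comm θ, abs_sub_comm (Real.exp _)]
    exact this hθ' hθ (le_of_not_ge h)
  rw [abs_of_nonneg (sub_nonneg.2 h),
    abs_of_nonneg (sub_nonneg.2 (Real.exp_le_exp.2 (by linarith)))]
  have h1 : Real.exp (-θ') = Real.exp (-θ) * Real.exp (θ - θ') := by
    rw [← Real.exp_add]; ring_nf
  have h2 : Real.exp (-M) ≤ Real.exp (-θ) := Real.exp_le_exp.2 (by linarith [abs_le.1 hθ])
  have h3 := Real.add_one_le_exp (θ - θ')
  rw [h1]
  nlinarith [Real.exp_pos (-θ)]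

theorem hellingerConst_mul_le {s M θ θ' : ℝ} (hs₀ : 0 < s)
    (hθ : |θ| ≤ M) (hθ' : |θ'| ≤ M) :
    s * hellingerConst M * (θ - θ') ^ 2 ≤ hellinger s θ θ' ^ 2 := by
  rw [hellinger, Real.sq_sqrt (by positivity)]
  suffices h : s * hellingerConst M * (θ - θ') ^ 2 ≤
      (√(edgeProb s θ) - √(edgeProb s θ')) ^ 2 from
    h.trans (le_add_of_nonneg_right (sq_nonneg _))
  set a := (1 + Real.exp (-θ))⁻¹ with ha
  set b := (1 + Real.exp (-θ'))⁻¹ with hb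
  have ha0 : 0 < a := by positivity
  have hb0 : 0 < b := by positivity
  have ha1 : a ≤ 1 := inv_le_one_of_one_le₀ (by linarith [Real.exp_pos (-θ)])
  have hb1 : b ≤ 1 := inv_le_one_of_one_le₀ (by linarith [Real.exp_pos (-θ')])
  have e : (√(edgeProb s θ) - √(edgeProb s θ')) ^ 2 = s * (√a - √b) ^ 2 := by
    unfold edgeProb
    rw [Real.sqrt_mul hs₀.le, Real.sqrt_mul hs₀.le, ← mul_sub, mul_pow, Real.sq_sqrt hs₀.le]
  rw [e, mul_assoc]
  refine mul_le_mul_of_nonneg_left ?_ hs₀.le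
  rw [hellingerConst, ← mul_pow, sq_le_sq]
  have h1 : |a - b| ≤ 2 * |√a - √b| := by
    have : a - b = (√a + √b) * (√a - √b) := by
      linear_combination -Real.sq_sqrt ha0.le + Real.sq_sqrt hb0.le
    rw [this, abs_mul, abs_of_nonneg (by positivity)]
    gcongr
    linarith [Real.sqrt_le_one.2 ha1, Real.sqrt_le_one.2 hb1]
  have h2 : |a - b| = |Real.exp (-θ') - Real.exp (-θ)| /
      ((1 + Real.exp (-θ)) * (1 + Real.exp (-θ'))) := by
    have p1 : 0 < 1 + Real.exp (-θ) := by positivity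
    have p2 : 0 < 1 + Real.exp (-θ') := by positivity
    have h : a - b = (Real.exp (-θ') - Real.exp (-θ)) /
        ((1 + Real.exp (-θ)) * (1 + Real.exp (-θ'))) := by
      rw [ha, hb]
      field_simp
      ring
    rw [h, abs_div, abs_of_pos (mul_pos p1 p2)]
  have h3 : Real.exp (-M) * |θ - θ'| / (1 + Real.exp M) ^ 2 ≤ |a - b| := by
    rw [h2, sq]
    have p1 : Real.exp (-θ) ≤ Real.exp M := Real.exp_le_exp.2 (by linarith [neg_abs_le θ])
    have p2 : Real.exp (-θ') ≤ Real.exp M := Real.exp_le_exp.2 (by linarith [neg_abs_le θ'])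
    gcongr
    exact exp_neg_mul_abs_sub_le hθ hθ'
  rw [abs_mul, abs_of_pos (by positivity)]
  calc Real.exp (-M) / (2 * (1 + Real.exp M) ^ 2) * |θ - θ'|
      = (Real.exp (-M) * |θ - θ'| / (1 + Real.exp M) ^ 2) / 2 := by
        field_simp
    _ ≤ |√a - √b| := by linarith

/-! ### Counting edge indices -/

/-- A monotone edge index is recovered from its set of vertices. -/
theorem vertices_injOn (m n : ℕ) :
    Set.InjOn (vertices (m := m) (n := n)) (edgeIndices m n) := by
  classical
  -- At the first position where two indices differ, the smaller entry has to occur earlier in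
  -- the other index, hence also in its own, where non-null entries do not repeat.
  have key : ∀ i ∈ edgeIndices m n, ∀ j ∈ edgeIndices m n, vertices i = vertices j →
      ∀ k, (∀ l < k, i l = j l) → ¬ i k < j k := by
    intro i hi j hj hij k hk hlt
    simp only [edgeIndices, Finset.mem_filter, Finset.mem_univ, true_and] at hi hj
    have hne : i k ≠ Fin.last n := (hlt.trans_le (Fin.le_last _)).ne
    obtain ⟨v, hv⟩ := Fin.exists_castSucc_eq.2 hne
    have hmem : v ∈ vertices j := by
      rw [← hij]
      simp only [vertices, Finset.mem_filter, Finset.mem_univ, true_and]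
      exact ⟨k, hv.symm⟩
    simp only [vertices, Finset.mem_filter, Finset.mem_univ, true_and] at hmem
    obtain ⟨l, hl⟩ := hmem
    have hlk : l < k := by
      by_contra hcon
      have := hj.2 (not_lt.1 hcon)
      rw [hl, hv] at this
      exact absurd hlt (not_lt.2 this)
    have := hi.1.2 k l hne (by rw [hk l hlk, hl, hv])
    exact absurd hlk (by rw [this]; exact lt_irrefl _)
  intro i hi j hj hij
  funext k
  induction k using WellFoundedLT.induction with
  | ind k ih =>
    rcases lt_trichotomy (i k) (j k) with h | h | h
    · exact absurd h (key i hi j hj hij k ih)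
    · exact h
    · exact absurd h (key j hj i hi hij.symm k fun l hl => (ih l hl).symm)

theorem card_edgeIndices_le (m n : ℕ) : (edgeIndices m n).card ≤ numEdges n m := by
  classical
  have hmaps : ∀ i ∈ edgeIndices m n, vertices i ∈
      (Finset.Icc 1 m).biUnion fun k => Finset.powersetCard k (Finset.univ : Finset (Fin n)) := by
    intro i hi
    simp only [edgeIndices, Finset.mem_filter, Finset.mem_univ, true_and] at hi
    obtain ⟨⟨⟨k, hk⟩, -⟩, -⟩ := hi
    simp only [Finset.mem_biUnion, Finset.mem_Icc, Finset.mem_powersetCard, Finset.subset_univ,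
      true_and]
    refine ⟨_, ⟨?_, ?_⟩, rfl⟩
    · obtain ⟨v, hv⟩ := Fin.exists_castSucc_eq.2 hk
      refine Finset.card_pos.2 ⟨v, ?_⟩
      simp only [vertices, Finset.mem_filter, Finset.mem_univ, true_and]
      exact ⟨k, hv.symm⟩
    · calc (vertices i).card = ((vertices i).map Fin.castSuccEmb).card := (Finset.card_map _).symm
        _ ≤ (Finset.univ.image i).card := by
            refine Finset.card_le_card fun x hx => ?_
            simp only [vertices, Finset.mem_map, Finset.mem_filter, Finset.mem_univ,
              true_and] at hx
            obtain ⟨v, ⟨l, hl⟩, rfl⟩ := hx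
            exact Finset.mem_image.2 ⟨l, Finset.mem_univ _, hl⟩
        _ ≤ m := Finset.card_image_le.trans (by simp)
  refine (Finset.card_le_card_of_injOn _ hmaps (vertices_injOn m n)).trans ?_
  refine Finset.card_biUnion_le.trans ?_
  simp [numEdges]

theorem numEdges_le (m : ℕ) {n : ℕ} (hn : 1 ≤ n) : numEdges n m ≤ m * n ^ m := by
  unfold numEdges
  refine (Finset.sum_le_card_nsmul _ _ (n ^ m) fun k hk => ?_).trans (by simp)
  exact (Nat.choose_le_pow n k).trans (Nat.pow_le_pow_right hn (Finset.mem_Icc.1 hk).2)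

theorem choose_two_le_numEdges {m : ℕ} (hm : 2 ≤ m) (n : ℕ) : n.choose 2 ≤ numEdges n m :=
  Finset.single_le_sum (f := fun k => n.choose k) (fun _ _ => Nat.zero_le _)
    (Finset.mem_Icc.2 ⟨by norm_num, hm⟩)

/-- Every edge index is a permutation of a monotone one, so that a sum of a symmetric
non-negative tensor over all edge indices is at most `m!` times that over the monotone ones. -/
theorem sum_isEdgeIndex_le {m n : ℕ} (f : Tensor m (n + 1)) (hf : ∀ i, 0 ≤ f i)
    (hsymm : ∀ (σ : Equiv.Perm (Fin m)) i, f (i ∘ σ) = f i) :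
    (open Classical in ∑ i with IsEdgeIndex i, f i) ≤
      m.factorial * ∑ i ∈ edgeIndices m n, f i := by
  classical
  have hperm : ∀ (σ : Equiv.Perm (Fin m)) (i : Fin m → Fin (n + 1)),
      IsEdgeIndex i → IsEdgeIndex (i ∘ σ) := by
    rintro σ i ⟨⟨k, hk⟩, h⟩
    refine ⟨⟨σ.symm k, by simpa using hk⟩, fun k l hk hkl => ?_⟩
    exact σ.injective (h _ _ hk hkl)
  calc (∑ i with IsEdgeIndex i, f i)
      ≤ ∑ i ∈ (Finset.univ ×ˢ edgeIndices m n).image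
          (fun p : Equiv.Perm (Fin m) × (Fin m → Fin (n + 1)) => p.2 ∘ p.1), f i := by
        refine Finset.sum_le_sum_of_subset_of_nonneg (fun i hi => ?_) fun i _ _ => hf i
        simp only [Finset.mem_filter, Finset.mem_univ, true_and] at hi
        refine Finset.mem_image.2 ⟨((Tuple.sort i)⁻¹, i ∘ Tuple.sort i), ?_, ?_⟩
        · simp only [edgeIndices, Finset.mem_product, Finset.mem_univ, true_and,
            Finset.mem_filter]
          exact ⟨hperm _ _ hi, Tuple.monotone_sort i⟩
        · funext k
          simp
    _ ≤ ∑ p ∈ Finset.univ ×ˢ edgeIndices m n,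
          f ((fun p : Equiv.Perm (Fin m) × (Fin m → Fin (n + 1)) => p.2 ∘ p.1) p) :=
        Finset.sum_image_le_of_nonneg fun i _ => hf i
    _ = m.factorial * ∑ i ∈ edgeIndices m n, f i := by
        rw [Finset.sum_product]
        simp [hsymm, Fintype.card_perm]

/-- An index that is no edge index repeats an entry. -/
theorem card_not_isEdgeIndex_le {m : ℕ} (hm : 2 ≤ m) (n : ℕ) :
    (open Classical in
      Finset.univ.filter fun i : Fin m → Fin (n + 1) => ¬ IsEdgeIndex i).card ≤
      m ^ 2 * (n + 1) ^ (m - 1) := by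
  classical
  have hsub : (Finset.univ.filter fun i : Fin m → Fin (n + 1) => ¬ IsEdgeIndex i) ⊆
      (Finset.univ : Finset (Fin m × Fin m)).biUnion fun p =>
        Finset.univ.filter fun i : Fin m → Fin (n + 1) => p.1 ≠ p.2 ∧ i p.1 = i p.2 := by
    intro i hi
    simp only [Finset.mem_filter, Finset.mem_univ, true_and, IsEdgeIndex, not_and_or, not_exists,
      not_not, not_forall] at hi
    simp only [Finset.mem_biUnion, Finset.mem_univ, Finset.mem_filter, true_and]
    rcases hi with h | ⟨k, l, -, hkl, hne⟩
    · exact ⟨(⟨0, by lia⟩, ⟨1, by lia⟩), by simp, by rw [h, h]⟩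
    · exact ⟨(k, l), hne, hkl⟩
  refine (Finset.card_le_card hsub).trans ?_
  refine (Finset.card_biUnion_le_card_mul _ _ ((n + 1) ^ (m - 1)) ?_).trans (by simp [sq])
  rintro ⟨k, l⟩ -
  by_cases hkl : k = l
  · simp [hkl]
  have hcard : Fintype.card ({x : Fin m // x ≠ k} → Fin (n + 1)) = (n + 1) ^ (m - 1) := by
    simp
  rw [← hcard, ← Finset.card_univ]
  refine Finset.card_le_card_of_injOn (fun i x => i x) 
    (fun _ _ => Finset.mem_coe.2 (Finset.mem_univ _)) ?_
  intro i hi j hj hij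
  simp only [Finset.coe_filter, Finset.mem_univ, true_and, Set.mem_ofPred_eq] at hi hj
  have hx : ∀ x, x ≠ k → i x = j x := fun x hx => congrFun hij ⟨x, hx⟩
  funext x
  by_cases h : x = k
  · rw [h, hi.2, hj.2]; exact hx l (Ne.symm hkl)
  · exact hx x h

/-! ### Tensors of embeddings -/

theorem IsEmbedding.abs_apply_le {c₀ : ℝ} {n r : ℕ} {α : Matrix (Fin (n + 1)) (Fin r) ℝ}
    (h : IsEmbedding c₀ α) (v : Fin n) (q : Fin r) : |α v.castSucc q| ≤ c₀ := by
  have := PiLp.norm_apply_le (WithLp.toLp 2 (α v.castSucc)) q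
  exact this.trans (h.2 v)

theorem IsEmbedding.abs_apply_le_max {c₀ : ℝ} {n r : ℕ} {α : Matrix (Fin (n + 1)) (Fin r) ℝ}
    (h : IsEmbedding c₀ α) (v : Fin (n + 1)) (q : Fin r) : |α v q| ≤ max 1 c₀ := by
  induction v using Fin.lastCases with
  | last => rw [h.1 q]; simp
  | cast v => exact (h.abs_apply_le v q).trans (le_max_right _ _)

theorem abs_prod_sub_prod_le {ι : Type*} (t : Finset ι) {a b : ι → ℝ} {B δ : ℝ} (hB : 1 ≤ B)
    (ha : ∀ k, |a k| ≤ B) (hb : ∀ k, |b k| ≤ B) (hab : ∀ k, |a k - b k| ≤ δ) :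
    |∏ k ∈ t, a k - ∏ k ∈ t, b k| ≤ t.card * B ^ t.card * δ := by
  classical
  induction t using Finset.induction_on with
  | empty => simp
  | insert k t hk ih =>
    have hδ : 0 ≤ δ := (abs_nonneg _).trans (hab k)
    rw [Finset.prod_insert hk, Finset.prod_insert hk, Finset.card_insert_of_notMem hk]
    have hA : |∏ k ∈ t, a k| ≤ B ^ t.card := by
      rw [Finset.abs_prod, ← Finset.prod_const]
      exact Finset.prod_le_prod (fun _ _ => abs_nonneg _) fun k _ => ha k
    calc |a k * ∏ k ∈ t, a k - b k * ∏ k ∈ t, b k|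
        = |(a k - b k) * ∏ k ∈ t, a k + b k * (∏ k ∈ t, a k - ∏ k ∈ t, b k)| := by ring_nf
      _ ≤ |a k - b k| * |∏ k ∈ t, a k| + |b k| * |∏ k ∈ t, a k - ∏ k ∈ t, b k| := by
          rw [← abs_mul, ← abs_mul]; exact abs_add_le _ _
      _ ≤ δ * B ^ t.card + B * (t.card * B ^ t.card * δ) := by
          gcongr
          · exact hab k
          · exact hb k
      _ ≤ B * (δ * B ^ t.card) + B * (t.card * B ^ t.card * δ) := by
          exact add_le_add_left (le_mul_of_one_le_left (by positivity) hB) _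
      _ = ((t.card + 1 : ℕ) : ℝ) * B ^ (t.card + 1) * δ := by push_cast; ring

theorem abs_embTensor_le {m n r : ℕ} (hm : 0 < m) {c₀ : ℝ}
    {α : Matrix (Fin (n + 1)) (Fin r) ℝ} (h : IsEmbedding c₀ α) (i : Fin m → Fin (n + 1)) :
    |embTensor m α i| ≤ r * max 1 c₀ ^ m := by
  rw [embTensor_apply hm]
  refine (Finset.abs_sum_le_sum_abs _ _).trans ?_
  refine (Finset.sum_le_card_nsmul _ _ (max 1 c₀ ^ m) fun q _ => ?_).trans (by simp)
  rw [Finset.abs_prod]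
  exact (Finset.prod_le_prod (fun _ _ => abs_nonneg _) fun k _ => h.abs_apply_le_max (i k) q).trans
    (by simp)

theorem abs_embTensor_sub_le {m n r : ℕ} (hm : 0 < m) {c₀ δ : ℝ} (hδ : 0 ≤ δ)
    {α β : Matrix (Fin (n + 1)) (Fin r) ℝ} (hα : IsEmbedding c₀ α) (hβ : IsEmbedding c₀ β)
    (hαβ : ∀ (v : Fin n) q, |α v.castSucc q - β v.castSucc q| ≤ δ) (i : Fin m → Fin (n + 1)) :
    |embTensor m α i - embTensor m β i| ≤ r * (m * max 1 c₀ ^ m) * δ := by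
  have h : ∀ v q, |α v q - β v q| ≤ δ := by
    intro v q
    induction v using Fin.lastCases with
    | last => rw [hα.1 q, hβ.1 q]; simpa using hδ
    | cast v => exact hαβ v q
  rw [embTensor_apply hm, embTensor_apply hm, ← Finset.sum_sub_distrib]
  refine (Finset.abs_sum_le_sum_abs _ _).trans ?_
  refine (Finset.sum_le_card_nsmul _ _ (m * max 1 c₀ ^ m * δ) fun q _ => ?_).trans
    (by simp [mul_assoc])
  refine (abs_prod_sub_prod_le _ (le_max_left 1 c₀) (fun k => hα.abs_apply_le_max (i k) q)
    (fun k => hβ.abs_apply_le_max (i k) q) fun k => h (i k) q).trans ?_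
  simp

theorem embTensor_comp_perm {m n r : ℕ} (hm : 0 < m) (α : Matrix (Fin (n + 1)) (Fin r) ℝ)
    (σ : Equiv.Perm (Fin m)) (i : Fin m → Fin (n + 1)) :
    embTensor m α (i ∘ σ) = embTensor m α i := by
  rw [embTensor_apply hm, embTensor_apply hm]
  refine Finset.sum_congr rfl fun q _ => ?_
  exact Equiv.prod_comp σ fun k => α (i k) q

theorem avgHellingerSq_nonneg {m n : ℕ} (s : ℝ) (Θ Θ' : Tensor m (n + 1)) :
    0 ≤ avgHellingerSq s Θ Θ' := by
  unfold avgHellingerSq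
  have : 0 ≤ ∑ i ∈ edgeIndices m n, hellinger s (Θ i) (Θ' i) ^ 2 :=
    Finset.sum_nonneg fun _ _ => sq_nonneg _
  positivity

theorem avgHellingerSq_lt_two {m n : ℕ} {s : ℝ} (hs₀ : 0 < s) (hs : s ≤ 1)
    (Θ Θ' : Tensor m (n + 1)) : avgHellingerSq s Θ Θ' < 2 := by
  unfold avgHellingerSq
  rcases Nat.eq_zero_or_pos (numEdges n m) with h0 | hpos
  · simp [h0]
  have hφ : (0 : ℝ) < numEdges n m := by exact_mod_cast hpos
  rw [inv_mul_lt_iff₀ hφ]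
  rcases (edgeIndices m n).eq_empty_or_nonempty with he | hne
  · simp [he, hpos]
  calc ∑ i ∈ edgeIndices m n, hellinger s (Θ i) (Θ' i) ^ 2
      < ∑ i ∈ edgeIndices m n, (2 : ℝ) :=
        Finset.sum_lt_sum_of_nonempty hne fun i _ => hellinger_sq_lt_two hs₀ hs _ _
    _ = (edgeIndices m n).card * 2 := by simp
    _ ≤ numEdges n m * 2 := by
        gcongr
        exact_mod_cast card_edgeIndices_le m n

/-- The Frobenius norm over the edge indices is controlled by the Hellinger distance. -/
theorem sum_isEdgeIndex_sq_le {m n r : ℕ} (hm : 0 < m) (hn : 1 ≤ n) {c₀ s : ℝ} (hs₀ : 0 < s)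
    {α β : Matrix (Fin (n + 1)) (Fin r) ℝ} (hα : IsEmbedding c₀ α) (hβ : IsEmbedding c₀ β) :
    (open Classical in ∑ i with IsEdgeIndex i, (embTensor m α i - embTensor m β i) ^ 2) ≤
      m.factorial * m / hellingerConst (r * max 1 c₀ ^ m) * (n : ℝ) ^ m *
        (avgHellingerSq s (embTensor m α) (embTensor m β) / s) := by
  classical
  set c := hellingerConst (r * max 1 c₀ ^ m)
  have hc : 0 < c := hellingerConst_pos _
  have h1 : (∑ i ∈ edgeIndices m n, (embTensor m α i - embTensor m β i) ^ 2) ≤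
      (s * c)⁻¹ * ∑ i ∈ edgeIndices m n, hellinger s (embTensor m α i) (embTensor m β i) ^ 2 := by
    rw [Finset.mul_sum]
    refine Finset.sum_le_sum fun i _ => ?_
    rw [le_inv_mul_iff₀ (by positivity)]
    exact hellingerConst_mul_le hs₀ (abs_embTensor_le hm hα i) (abs_embTensor_le hm hβ i)
  have h2 : (∑ i ∈ edgeIndices m n, hellinger s (embTensor m α i) (embTensor m β i) ^ 2) ≤
      m * (n : ℝ) ^ m * avgHellingerSq s (embTensor m α) (embTensor m β) := by
    have hle : (numEdges n m : ℝ) ≤ m * (n : ℝ) ^ m := by exact_mod_cast numEdges_le m hn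
    have hpos : (0 : ℝ) < numEdges n m := by
      have : n.choose 1 ≤ numEdges n m :=
        Finset.single_le_sum (f := fun k => n.choose k) (fun _ _ => Nat.zero_le _)
          (Finset.mem_Icc.2 ⟨le_rfl, hm⟩)
      rw [Nat.choose_one_right] at this
      exact_mod_cast hn.trans this
    refine le_trans (le_of_eq ?_)
      (mul_le_mul_of_nonneg_right hle (avgHellingerSq_nonneg s _ _))
    rw [avgHellingerSq, mul_inv_cancel_left₀ hpos.ne']
  refine (sum_isEdgeIndex_le (fun i => (embTensor m α i - embTensor m β i) ^ 2)
    (fun _ => sq_nonneg _) fun σ i => by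
      simp only [embTensor_comp_perm hm]).trans ?_
  calc (m.factorial : ℝ) * ∑ i ∈ edgeIndices m n, (embTensor m α i - embTensor m β i) ^ 2
      ≤ m.factorial * ((s * c)⁻¹ * (m * (n : ℝ) ^ m *
          avgHellingerSq s (embTensor m α) (embTensor m β))) := by gcongr; exact h1.trans (by gcongr)
    _ = _ := by field_simp

theorem sum_not_isEdgeIndex_sq_le {m n r : ℕ} (hm : 2 ≤ m) (hn : 1 ≤ n) {c₀ : ℝ}
    {α β : Matrix (Fin (n + 1)) (Fin r) ℝ} (hα : IsEmbedding c₀ α) (hβ : IsEmbedding c₀ β) :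
    (open Classical in ∑ i with ¬ IsEdgeIndex i, (embTensor m α i - embTensor m β i) ^ 2) ≤
      m ^ 2 * 2 ^ m * (2 * (r * max 1 c₀ ^ m)) ^ 2 * (n : ℝ) ^ m * (n : ℝ)⁻¹ := by
  classical
  have hcard : ((Finset.univ.filter fun i : Fin m → Fin (n + 1) => ¬ IsEdgeIndex i).card : ℝ) ≤
      m ^ 2 * 2 ^ m * (n : ℝ) ^ m * (n : ℝ)⁻¹ := by
    have hn' : (1 : ℝ) ≤ n := by exact_mod_cast hn
    have h : ((Finset.univ.filter fun i : Fin m → Fin (n + 1) => ¬ IsEdgeIndex i).card : ℝ) ≤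
        m ^ 2 * ((n : ℝ) + 1) ^ (m - 1) := by exact_mod_cast card_not_isEdgeIndex_le hm n
    refine h.trans ?_
    rw [mul_assoc, mul_assoc]
    refine mul_le_mul_of_nonneg_left ?_ (by positivity)
    calc ((n : ℝ) + 1) ^ (m - 1) ≤ (2 * n) ^ (m - 1) := by gcongr; linarith
      _ = 2 ^ (m - 1) * (n : ℝ) ^ (m - 1) := mul_pow _ _ _
      _ ≤ 2 ^ m * (n : ℝ) ^ (m - 1) := by gcongr <;> [norm_num; lia]
      _ = 2 ^ m * ((n : ℝ) ^ m * (n : ℝ)⁻¹) := by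
          congr 1
          rw [eq_mul_inv_iff_mul_eq₀ (by positivity), ← pow_succ]
          congr 1
          lia
  refine (Finset.sum_le_card_nsmul _ _ ((2 * (r * max 1 c₀ ^ m)) ^ 2) fun i _ => ?_).trans ?_
  · rw [sq_le_sq, abs_of_nonneg (a := 2 * ((r : ℝ) * max 1 c₀ ^ m)) (by positivity)]
    have h1 := abs_embTensor_le (by lia : 0 < m) hα i
    have h2 := abs_embTensor_le (by lia : 0 < m) hβ i
    have h3 := abs_sub (embTensor m α i) (embTensor m β i)
    linarith
  · rw [nsmul_eq_mul]
    calc _ ≤ (m ^ 2 * 2 ^ m * (n : ℝ) ^ m * (n : ℝ)⁻¹) * (2 * (r * max 1 c₀ ^ m)) ^ 2 := by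
          gcongr
      _ = _ := by ring

/-! ### Likelihood ratios of a fixed embedding -/

theorem mul_exp_half_log_sub {x y : ℝ} (hx : 0 < x) (hy : 0 < y) :
    x * Real.exp (1 / 2 * (Real.log y - Real.log x)) = √x * √y := by
  have hx' : √x = Real.exp (Real.log x / 2) := by rw [Real.exp_half, Real.exp_log hx]
  have hy' : √y = Real.exp (Real.log y / 2) := by rw [Real.exp_half, Real.exp_log hy]
  rw [hx', hy', ← Real.exp_add]
  nth_rewrite 1 [← Real.exp_log hx]
  rw [← Real.exp_add]
  ring_nf

/-- Excess of the loss of `Θ₀` over that of `Θ`, summed over the potential hyperedges: the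
log-likelihood ratio of `Θ` against `Θ₀`. -/
noncomputable def logLikRatio {m n : ℕ} (s : ℝ) (Θ Θ₀ A : Tensor m (n + 1)) : ℝ :=
  ∑ i ∈ edgeIndices m n, (entryLoss s (Θ₀ i) (A i) - entryLoss s (Θ i) (A i))

theorem adjacency_eq_zero_or_one (m : ℕ) {n : ℕ} (E : Finset (Finset (Fin n)))
    (i : Fin m → Fin (n + 1)) : adjacency m E i = 0 ∨ adjacency m E i = 1 := by
  unfold adjacency
  split_ifs <;> simp

/-- The mean of the square root of one likelihood ratio is the Hellinger affinity. -/
theorem mgf_entryLoss_sub_le {Ω : Type*} [MeasurableSpace Ω] {μ : Measure Ω}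
    [IsProbabilityMeasure μ] {s θ₀ θ : ℝ} (hs₀ : 0 < s) (hs : s ≤ 1) {G : Set Ω}
    (hG : MeasurableSet G) (hμ : μ.real G = edgeProb s θ₀) :
    Integrable (fun ω => Real.exp (1 / 2 * (entryLoss s θ₀ (G.indicator (fun _ => 1) ω) -
      entryLoss s θ (G.indicator (fun _ => 1) ω)))) μ ∧
    mgf (fun ω => entryLoss s θ₀ (G.indicator (fun _ => 1) ω) -
      entryLoss s θ (G.indicator (fun _ => 1) ω)) μ (1 / 2) ≤
      Real.exp (-(hellinger s θ₀ θ ^ 2 / 2)) := by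
  set a := Real.exp (1 / 2 * (Real.log (edgeProb s θ) - Real.log (edgeProb s θ₀))) with ha
  set b := Real.exp (1 / 2 * (Real.log (1 - edgeProb s θ) - Real.log (1 - edgeProb s θ₀))) with hb
  have hfun : (fun ω => Real.exp (1 / 2 * (entryLoss s θ₀ (G.indicator (fun _ => 1) ω) -
      entryLoss s θ (G.indicator (fun _ => 1) ω)))) =
      fun ω => b + G.indicator (fun _ => a - b) ω := by
    funext ω
    by_cases hω : ω ∈ G
    · simp only [Set.indicator_of_mem hω, entryLoss_one hs₀ hs, ha]
      ring_nf
    · simp only [Set.indicator_of_notMem hω, entryLoss_zero hs, hb]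
      ring_nf
  have hint : Integrable (G.indicator fun _ => a - b) μ :=
    (integrable_const _).indicator hG
  refine ⟨by rw [hfun]; exact (integrable_const _).add hint, ?_⟩
  rw [mgf, hfun, integral_add (integrable_const _) hint, integral_const,
    integral_indicator_const _ hG, hμ]
  have h1 := mul_exp_half_log_sub (edgeProb_pos hs₀ θ₀) (edgeProb_pos hs₀ θ)
  have h2 := mul_exp_half_log_sub (one_sub_edgeProb_pos hs θ₀) (one_sub_edgeProb_pos hs θ)
  rw [← ha] at h1
  rw [← hb] at h2
  have h3 := Real.add_one_le_exp (-(hellinger s θ₀ θ ^ 2 / 2))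
  rw [hellinger_sq hs₀ hs] at h3 ⊢
  simp only [probReal_univ, smul_eq_mul]
  linarith

/-- Chernoff bound for the log-likelihood ratio, at the exponent `1 / 2` for which the moment
generating function is a product of Hellinger affinities. -/
theorem measure_logLikRatio_ge_le {m n : ℕ} {Ω : Type*} [MeasurableSpace Ω] {μ : Measure Ω}
    [IsProbabilityMeasure μ] {s : ℝ} (hs₀ : 0 < s) (hs : s ≤ 1) {Θ₀ : Tensor m (n + 1)}
    {E : Ω → Finset (Finset (Fin n))} (hE : IsModel s Θ₀ μ E) (Θ : Tensor m (n + 1)) (t : ℝ) :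
    μ.real {ω | -t ≤ logLikRatio s Θ Θ₀ (adjacency m (E ω))} ≤
      Real.exp (t / 2 - (∑ i ∈ edgeIndices m n, hellinger s (Θ₀ i) (Θ i) ^ 2) / 2) := by
  classical
  let G : edgeIndices m n → Set Ω := fun i => {ω | vertices i.1 ∈ E ω}
  let g : edgeIndices m n → ℝ → ℝ := fun i a => entryLoss s (Θ₀ i) a - entryLoss s (Θ i) a
  let X : edgeIndices m n → Ω → ℝ := fun i => g i ∘ (G i).indicator fun _ => 1
  have hg : ∀ i, Measurable (g i) := fun i => by
    simp only [g, entryLoss]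
    fun_prop
  have hGm : ∀ i, MeasurableSet (G i) := fun i => hE.measurableSet i i.2
  have hXm : ∀ i, Measurable (X i) := fun i => (hg i).comp (measurable_const.indicator (hGm i))
  have hind : iIndepFun X μ := by
    have h : iIndepFun (fun i => (G i).indicator fun _ => (1 : ℝ)) μ :=
      iIndepSet.iIndepFun_indicator hE.indep
    exact h.comp g hg
  have hsum : ∀ ω, logLikRatio s Θ Θ₀ (adjacency m (E ω)) = (∑ i, X i) ω := by
    intro ω
    rw [logLikRatio, Finset.sum_apply, ← Finset.sum_coe_sort]
    refine Finset.sum_congr rfl fun i _ => ?_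
    have hi : IsEdgeIndex i.1 := (Finset.mem_filter.1 i.2).2.1
    have : adjacency m (E ω) i = (G i).indicator (fun _ => 1) ω := by
      simp [adjacency, hi, G, Set.indicator_apply]
    simp only [X, g, Function.comp_apply, this]
  have hmgf := fun i : edgeIndices m n => mgf_entryLoss_sub_le (μ := μ) (θ := Θ i) hs₀ hs (hGm i)
    (hE.prob i i.2)
  simp_rw [hsum]
  refine (measure_ge_le_exp_mul_mgf (t := 1 / 2) (-t) (by norm_num)
    (hind.integrable_exp_mul_sum hXm fun i _ => (hmgf i).1)).trans ?_
  rw [hind.mgf_sum hXm]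
  have hprod : ∏ i, mgf (X i) μ (1 / 2) ≤
      ∏ i : edgeIndices m n, Real.exp (-(hellinger s (Θ₀ i) (Θ i) ^ 2 / 2)) :=
    Finset.prod_le_prod (fun _ _ => mgf_nonneg) fun i _ => (hmgf i).2
  rw [← Real.exp_sum, Finset.sum_coe_sort (edgeIndices m n)
    (fun i => -(hellinger s (Θ₀ i) (Θ i) ^ 2 / 2)), Finset.sum_neg_distrib,
    ← Finset.sum_div] at hprod
  refine (mul_le_mul_of_nonneg_left hprod (Real.exp_pos _).le).trans ?_
  rw [← Real.exp_add]
  exact Real.exp_le_exp.2 (by linarith)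

/-! ### The penalized estimator and the union bound -/

theorem frobeniusSq_nonneg {N r : ℕ} (M : Matrix (Fin N) (Fin r) ℝ) : 0 ≤ frobeniusSq M :=
  Finset.sum_nonneg fun _ _ => Finset.sum_nonneg fun _ _ => sq_nonneg _

theorem penalty_nonneg (K : ℕ) {l₀ l₁ : ℝ} (h₀ : 0 ≤ l₀) (h₁ : 0 ≤ l₁) {n r : ℕ}
    (α : Matrix (Fin (n + 1)) (Fin r) ℝ) : 0 ≤ penalty K l₀ l₁ α := by
  refine add_nonneg (mul_nonneg h₀ ?_) (mul_nonneg h₁ (Real.iInf_nonneg fun p => ?_))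
  · exact mul_nonneg (by positivity) (frobeniusSq_nonneg _)
  · exact mul_nonneg (by positivity) (frobeniusSq_nonneg _)

/-- The estimate has almost the likelihood of the true embedding. -/
theorem IsEstimate.neg_le_logLikRatio {m K n r : ℕ} {c₀ s l₀ l₁ ε : ℝ}
    (hφ : 0 < numEdges n m) (h₀ : 0 ≤ l₀) (h₁ : 0 ≤ l₁) {A : Tensor m (n + 1)}
    {α α₀ : Matrix (Fin (n + 1)) (Fin r) ℝ} (hα : IsEstimate m K c₀ s l₀ l₁ A α)
    (hα₀ : IsEmbedding c₀ α₀) (hpen : penalty K l₀ l₁ α₀ < 1 / 2 * ε) :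
    -(numEdges n m * ε / 2) ≤ logLikRatio s (embTensor m α) (embTensor m α₀) A := by
  have h := hα.2 α₀ hα₀
  have hpos := penalty_nonneg K h₀ h₁ α
  have hφ' : (0 : ℝ) < numEdges n m := by exact_mod_cast hφ
  have e : (numEdges n m : ℝ)⁻¹ * logLikRatio s (embTensor m α) (embTensor m α₀) A =
      negLogLik s (embTensor m α₀) A - negLogLik s (embTensor m α) A := by
    simp only [negLogLik, logLikRatio, Finset.sum_sub_distrib, mul_sub]
  have h' : -(ε / 2) ≤
      (numEdges n m : ℝ)⁻¹ * logLikRatio s (embTensor m α) (embTensor m α₀) A := by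
    rw [e]
    unfold objective at h
    linarith
  rw [le_inv_mul_iff₀ hφ'] at h'
  linarith

theorem logLikRatio_sub_le {m n : ℕ} {s η : ℝ} (hs₀ : 0 < s) (hs : s ≤ 1) (hη : 0 ≤ η)
    {Θ Θ' : Tensor m (n + 1)} (Θ₀ : Tensor m (n + 1)) (h : ∀ i, |Θ i - Θ' i| ≤ η)
    (E : Finset (Finset (Fin n))) :
    logLikRatio s Θ Θ₀ (adjacency m E) - numEdges n m * η ≤
      logLikRatio s Θ' Θ₀ (adjacency m E) := by
  have hc : ((edgeIndices m n).card : ℝ) * η ≤ numEdges n m * η := by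
    gcongr
    exact_mod_cast card_edgeIndices_le m n
  have h1 : logLikRatio s Θ Θ₀ (adjacency m E) - logLikRatio s Θ' Θ₀ (adjacency m E) ≤
      (edgeIndices m n).card * η := by
    rw [logLikRatio, logLikRatio, ← Finset.sum_sub_distrib, ← nsmul_eq_mul]
    refine Finset.sum_le_card_nsmul _ _ _ fun i _ => ?_
    have := entryLoss_le_add hs₀ hs (Θ' i) (Θ i) (adjacency_eq_zero_or_one m E i)
    rw [abs_sub_comm] at this
    linarith [h i]
  linarith

theorem hellinger_comm (s θ θ' : ℝ) : hellinger s θ θ' = hellinger s θ' θ := by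
  unfold hellinger
  congr 1
  ring

/-- The cell of an embedding in the cubic grid of width `w`. -/
noncomputable def gridCell (w : ℝ) {n r : ℕ} (α : Matrix (Fin (n + 1)) (Fin r) ℝ) :
    Fin n → Fin r → ℤ :=
  fun v q => ⌊α v.castSucc q / w⌋

/-- The cells of the grid of width `w` that can be met by an embedding. -/
noncomputable def gridCells (c₀ w : ℝ) (n r : ℕ) : Finset (Fin n → Fin r → ℤ) :=
  Fintype.piFinset fun _ => Fintype.piFinset fun _ => Finset.Icc (-⌈c₀ / w⌉) ⌈c₀ / w⌉

theorem IsEmbedding.gridCell_mem {c₀ w : ℝ} (hw : 0 < w) {n r : ℕ}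
    {α : Matrix (Fin (n + 1)) (Fin r) ℝ} (hα : IsEmbedding c₀ α) :
    gridCell w α ∈ gridCells c₀ w n r := by
  simp only [gridCells, Fintype.mem_piFinset, Finset.mem_Icc, gridCell]
  intro v q
  have h := abs_le.1 (hα.abs_apply_le v q)
  have h1 : -(c₀ / w) ≤ α v.castSucc q / w := by
    rw [← neg_div]; exact div_le_div_of_nonneg_right h.1 hw.le
  have h2 : α v.castSucc q / w ≤ c₀ / w := div_le_div_of_nonneg_right h.2 hw.le
  have h3 := Int.le_ceil (c₀ / w)
  constructor
  · rw [Int.le_floor]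
    push_cast
    linarith
  · exact_mod_cast (Int.floor_le _).trans (h2.trans h3)

theorem card_gridCells_le {c₀ w : ℝ} (hc₀ : 0 < c₀) (hw : 0 < w) (n r : ℕ) :
    ((gridCells c₀ w n r).card : ℝ) ≤ (2 * (c₀ / w) + 3) ^ (n * r) := by
  have hpos : 0 < c₀ / w := by positivity
  have h0 : (0 : ℤ) ≤ ⌈c₀ / w⌉ := Int.ceil_nonneg hpos.le
  have hcard : (((Finset.Icc (-⌈c₀ / w⌉) ⌈c₀ / w⌉).card : ℕ) : ℝ) ≤ 2 * (c₀ / w) + 3 := by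
    rw [Int.card_Icc]
    have h1 : (((⌈c₀ / w⌉ + 1 - -⌈c₀ / w⌉).toNat : ℤ) : ℝ) = 2 * (⌈c₀ / w⌉ : ℝ) + 1 := by
      rw [Int.toNat_of_nonneg (by lia)]
      push_cast
      ring
    rw [Int.cast_natCast] at h1
    rw [h1]
    linarith [Int.ceil_lt_add_one (c₀ / w)]
  simp only [gridCells, Fintype.card_piFinset, Finset.prod_const, Finset.card_univ,
    Fintype.card_fin, Nat.cast_pow, ← pow_mul]
  rw [mul_comm r n]
  gcongr

theorem abs_sub_le_of_gridCell_eq {w : ℝ} (hw : 0 < w) {n r : ℕ}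
    {α β : Matrix (Fin (n + 1)) (Fin r) ℝ} (h : gridCell w α = gridCell w β) (v : Fin n)
    (q : Fin r) : |α v.castSucc q - β v.castSucc q| ≤ w := by
  have := (Int.abs_sub_lt_one_of_floor_eq_floor (congrFun (congrFun h v) q)).le
  rwa [← sub_div, abs_div, abs_of_pos hw, div_le_one₀ hw] at this

/-- Ratio of the grid width to the radius `ε`: two embeddings in one cell have tensors that differ
by at most `ε / 4`. -/
noncomputable def widthRatio (m r : ℕ) (c₀ : ℝ) : ℝ := (4 * (r * (m * max 1 c₀ ^ m)))⁻¹

theorem widthRatio_pos {m r : ℕ} (hm : 0 < m) (hr : 0 < r) (c₀ : ℝ) : 0 < widthRatio m r c₀ := by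
  have : 0 < max 1 c₀ := lt_max_of_lt_left one_pos
  unfold widthRatio
  positivity

/-- Union bound over the grid. A cell that contains a `D`-distant embedding is represented by such
an embedding, so that the Chernoff bound applies to the representative, and passing to the
representative costs at most `ε / 4` per entry of the log-likelihood. -/
theorem measure_avgHellingerSq_ge_le {m n r K : ℕ} (hm : 0 < m) (hr : 0 < r) {c₀ : ℝ}
    (hc₀ : 0 < c₀) {Ω : Type*} [MeasurableSpace Ω] {μ : Measure Ω} [IsProbabilityMeasure μ]
    {s l₀ l₁ ε : ℝ} (hs₀ : 0 < s) (hs : s ≤ 1) (h₀ : 0 ≤ l₀) (h₁ : 0 ≤ l₁) (hε : 0 < ε)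
    (hφ : 0 < numEdges n m)
    {α₀ : Matrix (Fin (n + 1)) (Fin r) ℝ} {E : Ω → Finset (Finset (Fin n))}
    {α : Ω → Matrix (Fin (n + 1)) (Fin r) ℝ} (hα₀ : IsEmbedding c₀ α₀)
    (hE : IsModel s (embTensor m α₀) μ E)
    (hα : ∀ ω, IsEstimate m K c₀ s l₀ l₁ (adjacency m (E ω)) (α ω))
    (hpen : penalty K l₀ l₁ α₀ < 1 / 2 * ε) :
    μ.real {ω | ε ≤ avgHellingerSq s (embTensor m (α ω)) (embTensor m α₀)} ≤
      (2 * (c₀ / (widthRatio m r c₀ * ε)) + 3) ^ (n * r) *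
        Real.exp (-(numEdges n m * ε / 8)) := by
  classical
  have hκ := widthRatio_pos hm hr c₀
  have hφ' : (0 : ℝ) < numEdges n m := by exact_mod_cast hφ
  set w := widthRatio m r c₀ * ε with hw
  have hw0 : 0 < w := by positivity
  have hlip : (r * (m * max 1 c₀ ^ m)) * w = ε / 4 := by
    have : 0 < max 1 c₀ := lt_max_of_lt_left one_pos
    rw [hw, widthRatio]
    field_simp
  let S : Set (Matrix (Fin (n + 1)) (Fin r) ℝ) :=
    {β | IsEmbedding c₀ β ∧ ε ≤ avgHellingerSq s (embTensor m β) (embTensor m α₀)}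
  let T := (gridCells c₀ w n r).filter fun t => ∃ β ∈ S, gridCell w β = t
  have hT : ∀ t : Fin n → Fin r → ℤ, ∃ β, t ∈ T → β ∈ S ∧ gridCell w β = t := by
    intro t
    by_cases ht : t ∈ T
    · obtain ⟨β, hβ⟩ := (Finset.mem_filter.1 ht).2
      exact ⟨β, fun _ => hβ⟩
    · exact ⟨0, fun h => absurd h ht⟩
  choose ρ hρ using hT
  let bad : (Fin n → Fin r → ℤ) → Set Ω := fun t =>
    {ω | -(3 * (numEdges n m * ε / 4)) ≤
      logLikRatio s (embTensor m (ρ t)) (embTensor m α₀) (adjacency m (E ω))}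
  have hsub : {ω | ε ≤ avgHellingerSq s (embTensor m (α ω)) (embTensor m α₀)} ⊆
      ⋃ t ∈ T, bad t := by
    intro ω hω
    have hS : α ω ∈ S := ⟨(hα ω).1, hω⟩
    have hmem : gridCell w (α ω) ∈ T :=
      Finset.mem_filter.2 ⟨(hα ω).1.gridCell_mem hw0, α ω, hS, rfl⟩
    refine Set.mem_biUnion (x := gridCell w (α ω)) hmem ?_
    obtain ⟨hρS, hρc⟩ := hρ _ hmem
    have h1 := (hα ω).neg_le_logLikRatio hφ h₀ h₁ hα₀ hpen
    have h2 := logLikRatio_sub_le hs₀ hs (η := ε / 4) (by positivity) (embTensor m α₀)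
      (fun i => (abs_embTensor_sub_le hm hw0.le (hα ω).1 hρS.1
        (abs_sub_le_of_gridCell_eq hw0 hρc.symm) i).trans hlip.le) (E ω)
    change -(3 * (numEdges n m * ε / 4)) ≤ _
    linarith
  have hbad : ∀ t ∈ T, μ.real (bad t) ≤ Real.exp (-(numEdges n m * ε / 8)) := by
    intro t ht
    refine (measure_logLikRatio_ge_le hs₀ hs hE _ _).trans (Real.exp_le_exp.2 ?_)
    have hD := (hρ t ht).1.2
    rw [avgHellingerSq, le_inv_mul_iff₀ hφ'] at hD
    simp_rw [hellinger_comm s (embTensor m α₀ _)]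
    linarith
  calc μ.real {ω | ε ≤ avgHellingerSq s (embTensor m (α ω)) (embTensor m α₀)}
      ≤ μ.real (⋃ t ∈ T, bad t) := measureReal_mono hsub (measure_ne_top _ _)
    _ ≤ ∑ t ∈ T, μ.real (bad t) := measureReal_biUnion_finset_le _ _
    _ ≤ T.card • Real.exp (-(numEdges n m * ε / 8)) := Finset.sum_le_card_nsmul _ _ _ hbad
    _ ≤ _ := by
        rw [nsmul_eq_mul]
        refine mul_le_mul_of_nonneg_right ?_ (Real.exp_pos _).le
        refine le_trans ?_ (card_gridCells_le hc₀ hw0 n r)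
        exact_mod_cast Finset.card_filter_le _ _

/-! ### Asymptotics -/

/-- The entropy `n r log (C / ε)` of the grid is eventually negligible with respect to the
exponent of the Chernoff bound. For small `ε` this is the growth condition on `ε`, for `ε` bounded
away from `0` it holds because there are quadratically many potential hyperedges. -/
theorem eventually_entropy_le {m : ℕ} (hm : 2 ≤ m) (r : ℕ) {C : ℝ} (hC : 1 ≤ C) {ε : ℕ → ℝ}
    (hε : ∀ n, 0 < ε n)
    (hlim : Tendsto (fun n : ℕ => (n : ℝ) * (numEdges n m : ℝ)⁻¹ * (ε n)⁻¹ *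
      Real.log ((ε n) ^ (-(1 / 2) : ℝ))) atTop (𝓝 0)) :
    ∀ᶠ n : ℕ in atTop, (n * r : ℝ) * Real.log (C / ε n) ≤ numEdges n m * ε n / 16 := by
  have hl2 : 0 < Real.log 2 := Real.log_pos (by norm_num)
  have hL : 0 ≤ Real.log C := Real.log_nonneg hC
  set A : ℝ := 2 * r * (1 + Real.log C / Real.log 2) with hA
  have hA0 : 0 ≤ A := by positivity
  have hev : ∀ᶠ n : ℕ in atTop, (n : ℝ) * (numEdges n m : ℝ)⁻¹ * (ε n)⁻¹ *
      Real.log ((ε n) ^ (-(1 / 2) : ℝ)) < 1 / (16 * (A + 1)) :=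
    hlim.eventually_lt_const (by positivity)
  have hlarge : ∀ᶠ n : ℕ in atTop, 64 * r * Real.log (2 * C) + 1 ≤ (n : ℝ) :=
    tendsto_natCast_atTop_atTop.eventually_ge_atTop _
  filter_upwards [hev, hlarge, eventually_ge_atTop 2] with n h1 h2 hn
  have hφ2 : (n : ℝ) * (n - 1) / 2 ≤ numEdges n m := by
    rw [← Nat.cast_choose_two]
    exact_mod_cast choose_two_le_numEdges hm n
  have hn' : (2 : ℝ) ≤ n := by exact_mod_cast hn
  have hφ : (0 : ℝ) < numEdges n m := lt_of_lt_of_le (by nlinarith) hφ2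
  have hεn := hε n
  rcases lt_or_ge (ε n) (1 / 2) with hsmall | hbig
  · rw [Real.log_rpow hεn] at h1
    have hlog : Real.log 2 ≤ -Real.log (ε n) := by
      rw [← Real.log_inv]
      refine Real.log_le_log (by norm_num) ?_
      rw [le_inv_comm₀ (by norm_num) hεn]
      linarith
    have h3 : Real.log (C / ε n) ≤ (1 + Real.log C / Real.log 2) * -Real.log (ε n) := by
      rw [Real.log_div (by positivity) hεn.ne', add_mul, div_mul_eq_mul_div]
      have : Real.log C ≤ Real.log C * -Real.log (ε n) / Real.log 2 := by
        rw [le_div_iff₀ hl2]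
        gcongr
      linarith
    have h4 : (n : ℝ) * (-(1 / 2) * Real.log (ε n)) ≤
        1 / (16 * (A + 1)) * (numEdges n m * ε n) := by
      rw [← div_le_iff₀ (by positivity)]
      refine le_trans (le_of_eq ?_) h1.le
      field_simp
    calc (n * r : ℝ) * Real.log (C / ε n)
        ≤ (n * r : ℝ) * ((1 + Real.log C / Real.log 2) * -Real.log (ε n)) := by gcongr
      _ = A * (n * (-(1 / 2) * Real.log (ε n))) := by rw [hA]; ring
      _ ≤ A * (1 / (16 * (A + 1)) * (numEdges n m * ε n)) := by gcongr
      _ = A / (A + 1) * (numEdges n m * ε n / 16) := by field_simp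
      _ ≤ 1 * (numEdges n m * ε n / 16) := by
          gcongr
          exact (div_le_one₀ (by positivity)).2 (by linarith)
      _ = _ := one_mul _
  · have h3 : Real.log (C / ε n) ≤ Real.log (2 * C) := by
      refine Real.log_le_log (by positivity) ?_
      rw [div_le_iff₀ hεn]
      nlinarith
    have h4 : (r : ℝ) * Real.log (2 * C) ≤ (n - 1) / 64 := by linarith
    calc (n * r : ℝ) * Real.log (C / ε n)
        ≤ (n * r : ℝ) * Real.log (2 * C) := by gcongr
      _ = n * (r * Real.log (2 * C)) := by ring
      _ ≤ n * ((n - 1) / 64) := by gcongr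
      _ = (n : ℝ) * (n - 1) / 2 * (1 / 2) / 16 := by ring
      _ ≤ numEdges n m * ε n / 16 := by gcongr

/-- The tail bound, together with the fact that it tends to zero. -/
theorem eventually_tail_le {m r : ℕ} (hm : 2 ≤ m) (hr : 2 ≤ r) {c₀ : ℝ} (hc₀ : 0 < c₀)
    {Ω : ℕ → Type*} [∀ n, MeasurableSpace (Ω n)]
    {μ : ∀ n, Measure (Ω n)} [∀ n, IsProbabilityMeasure (μ n)]
    {K : ℕ → ℕ} {s l₀ l₁ ε : ℕ → ℝ} {αs : ∀ n, Matrix (Fin (n + 1)) (Fin r) ℝ}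
    {E : ∀ n, Ω n → Finset (Finset (Fin n))}
    {αh : ∀ n, Ω n → Matrix (Fin (n + 1)) (Fin r) ℝ}
    (hs : ∀ n, 0 < s n ∧ s n ≤ 1) (h₀ : ∀ n, 0 < l₀ n) (h₁ : ∀ n, 0 < l₁ n) (hε : ∀ n, 0 < ε n)
    (hαs : ∀ n, IsEmbedding c₀ (αs n))
    (hE : ∀ n, IsModel (s n) (embTensor m (αs n)) (μ n) (E n))
    (hαh : ∀ n ω, IsEstimate m (K n) c₀ (s n) (l₀ n) (l₁ n) (adjacency m (E n ω)) (αh n ω))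
    (hpen : ∀ n, penalty (K n) (l₀ n) (l₁ n) (αs n) < 1 / 2 * ε n)
    (hlim : Tendsto (fun n : ℕ => (n : ℝ) * (numEdges n m : ℝ)⁻¹ * (ε n)⁻¹ *
      Real.log ((ε n) ^ (-(1 / 2) : ℝ))) atTop (𝓝 0)) :
    ∀ᶠ n : ℕ in atTop,
      (μ n).real {ω | ε n ≤ avgHellingerSq (s n) (embTensor m (αh n ω)) (embTensor m (αs n))} ≤
        Real.exp (-(numEdges n m * ε n / 16)) ∧
      (μ n).real {ω | ε n ≤ avgHellingerSq (s n) (embTensor m (αh n ω)) (embTensor m (αs n))} ≤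
        Real.exp (-n) := by
  have hκ := widthRatio_pos (by lia : 0 < m) (by lia : 0 < r) c₀
  set C : ℝ := 2 * (c₀ / widthRatio m r c₀) + 6 with hC
  have hC6 : 6 ≤ C := by
    have : 0 < c₀ / widthRatio m r c₀ := by positivity
    linarith
  filter_upwards [eventually_entropy_le hm r (by linarith : 1 ≤ C) hε hlim,
    eventually_ge_atTop 2] with n hn hn2
  obtain ⟨hs0, hs1⟩ := hs n
  have hεn := hε n
  rcases le_or_gt 2 (ε n) with hbig | hsmall
  · -- The squared Hellinger distance is less than `2`, so that the event is empty.
    have hempty : {ω | ε n ≤ avgHellingerSq (s n) (embTensor m (αh n ω))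
        (embTensor m (αs n))} = ∅ := by
      refine Set.eq_empty_of_forall_notMem fun ω hω => ?_
      exact absurd (hbig.trans hω) (not_le.2 (avgHellingerSq_lt_two hs0 hs1 _ _))
    rw [hempty, measureReal_empty]
    exact ⟨(Real.exp_pos _).le, (Real.exp_pos _).le⟩
  have hφ : 0 < numEdges n m := by
    have h := choose_two_le_numEdges hm n
    have := Nat.choose_pos hn2
    lia
  have hbound := measure_avgHellingerSq_ge_le (by lia : 0 < m) (by lia : 0 < r) hc₀ hs0 hs1
    (h₀ n).le (h₁ n).le hεn hφ (hαs n) (hE n) (hαh n) (hpen n)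
  have hCε : 3 ≤ C / ε n := by
    rw [le_div_iff₀ hεn]
    linarith
  have hcount : (2 * (c₀ / (widthRatio m r c₀ * ε n)) + 3) ^ (n * r) ≤
      Real.exp (numEdges n m * ε n / 16) := by
    calc (2 * (c₀ / (widthRatio m r c₀ * ε n)) + 3) ^ (n * r) ≤ (C / ε n) ^ (n * r) := by
          gcongr
          rw [hC, add_div, ← div_div, mul_div_assoc]
          gcongr
          rw [le_div_iff₀ hεn]
          linarith
      _ = Real.exp ((n * r : ℝ) * Real.log (C / ε n)) := by
          rw [← Nat.cast_mul, Real.exp_nat_mul, Real.exp_log (by linarith)]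
      _ ≤ _ := Real.exp_le_exp.2 hn
  have h1 : (μ n).real {ω | ε n ≤ avgHellingerSq (s n) (embTensor m (αh n ω))
      (embTensor m (αs n))} ≤ Real.exp (-(numEdges n m * ε n / 16)) := by
    refine hbound.trans ((mul_le_mul_of_nonneg_right hcount (Real.exp_pos _).le).trans ?_)
    rw [← Real.exp_add]
    exact Real.exp_le_exp.2 (by linarith)
  refine ⟨h1, h1.trans (Real.exp_le_exp.2 (neg_le_neg ?_))⟩
  refine le_trans ?_ hn
  have hlog : 1 ≤ Real.log (C / ε n) := by
    rw [Real.le_log_iff_exp_le (by linarith)]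
    exact Real.exp_one_lt_three.le.trans hCε
  have hr' : (1 : ℝ) ≤ r := by exact_mod_cast (by lia : 1 ≤ r)
  calc (n : ℝ) = n * 1 * 1 := by ring
    _ ≤ n * r * Real.log (C / ε n) := by gcongr

theorem isBigOp_of_eventually_bound {Ω : ℕ → Type*} [∀ n, MeasurableSpace (Ω n)]
    {μ : ∀ n, Measure (Ω n)} [∀ n, IsProbabilityMeasure (μ n)] {X : ∀ n, Ω n → ℝ} {a : ℕ → ℝ}
    {bad : ∀ n, Set (Ω n)} (hbad : ∀ᶠ n : ℕ in atTop, (μ n).real (bad n) ≤ Real.exp (-n))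
    {M : ℝ} (hM : 0 < M) (hX : ∀ᶠ n in atTop, ∀ ω ∉ bad n, |X n ω| ≤ M * a n) :
    IsBigOp μ X a := by
  intro δ hδ
  refine ⟨M, hM, ?_⟩
  have hexp : ∀ᶠ n : ℕ in atTop, Real.exp (-(n : ℝ)) < δ :=
    ((Real.tendsto_exp_neg_atTop_nhds_zero.comp
      tendsto_natCast_atTop_atTop).eventually_lt_const hδ)
  filter_upwards [hbad, hX, hexp] with n h1 h2 h3
  refine (measureReal_mono (fun ω hω => ?_) (measure_ne_top _ _)).trans (h1.trans h3.le)
  by_contra hcon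
  exact absurd hω (not_lt.2 (h2 ω hcon))

theorem rpow_mul_sqrt_le {n m : ℕ} (hn : 1 ≤ n) {S B y : ℝ} (hB : 0 ≤ B)
    (hS : S ≤ B * (n : ℝ) ^ m * y) : (n : ℝ) ^ (-(m : ℝ) / 2) * √S ≤ √B * √y := by
  have hn' : (0 : ℝ) < n := by exact_mod_cast hn
  have e : (n : ℝ) ^ (-(m : ℝ) / 2) = √(((n : ℝ) ^ m)⁻¹) := by
    rw [Real.sqrt_eq_rpow, ← Real.rpow_natCast, ← Real.rpow_neg hn'.le, ← Real.rpow_mul hn'.le]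
    congr 1
    ring
  rw [e, ← Real.sqrt_mul (by positivity), ← Real.sqrt_mul hB]
  refine Real.sqrt_le_sqrt ?_
  rw [inv_mul_le_iff₀ (by positivity)]
  linarith

theorem frobenius_edgePart {m n : ℕ} (T : Tensor m (n + 1)) :
    (edgePart T).frobenius = √(open Classical in ∑ i with IsEdgeIndex i, T i ^ 2) := by
  classical
  rw [Tensor.frobenius, Finset.sum_filter]
  congr 1
  refine Finset.sum_congr rfl fun i _ => ?_
  unfold edgePart
  split_ifs <;> simp

end HEM

theorem theorem1 (m r : ℕ) (hm : 2 ≤ m) (hr : 2 ≤ r) (c₀ : ℝ) (hc₀ : 0 < c₀) :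
    ∃ c₁ : ℝ, 0 < c₁ ∧
      ∀ (Ω : ℕ → Type*) [∀ n, MeasurableSpace (Ω n)]
        (μ : ∀ n, Measure (Ω n)) [∀ n, IsProbabilityMeasure (μ n)]
        (K : ℕ → ℕ) (s l₀ l₁ ε : ℕ → ℝ)
        (αs : ∀ n, Matrix (Fin (n + 1)) (Fin r) ℝ)
        (E : ∀ n, Ω n → Finset (Finset (Fin n)))
        (αh : ∀ n, Ω n → Matrix (Fin (n + 1)) (Fin r) ℝ),
        (∀ n, 1 ≤ K n) →
        (∀ n, 0 < s n ∧ s n ≤ 1) →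
        (∀ n, 0 < l₀ n) →
        (∀ n, 0 < l₁ n) →
        (∀ n, 0 < ε n) →
        (∀ n, HEM.IsEmbedding c₀ (αs n)) →
        (∀ n, HEM.IsModel (s n) (HEM.embTensor m (αs n)) (μ n) (E n)) →
        (∀ n ω, HEM.IsEstimate m (K n) c₀ (s n) (l₀ n) (l₁ n)
          (HEM.adjacency m (E n ω)) (αh n ω)) →
        (∀ n, HEM.penalty (K n) (l₀ n) (l₁ n) (αs n) < 1 / 2 * ε n) →
        Tendsto (fun n : ℕ => (n : ℝ) * (HEM.numEdges n m : ℝ)⁻¹ * (ε n)⁻¹ *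
          Real.log ((ε n) ^ (-(1 / 2) : ℝ))) atTop (𝓝 0) →
        (∀ᶠ n in atTop,
          (μ n).real {ω | ε n ≤ HEM.avgHellingerSq (s n)
              (HEM.embTensor m (αh n ω)) (HEM.embTensor m (αs n))}
            ≤ 4 * Real.exp (-c₁ * (HEM.numEdges n m : ℝ) * ε n)) ∧
        HEM.IsBigOp μ (fun n ω => HEM.avgHellingerSq (s n)
          (HEM.embTensor m (αh n ω)) (HEM.embTensor m (αs n))) ε ∧
        HEM.IsBigOp μ (fun n ω => (n : ℝ) ^ (-(m : ℝ) / 2) *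
          HEM.Tensor.frobenius (HEM.edgePart
            (HEM.embTensor m (αh n ω) - HEM.embTensor m (αs n))))
          (fun n => √(ε n / s n)) ∧
        ((fun n : ℕ => (n : ℝ)⁻¹) =O[atTop] (fun n => ε n / s n) →
          HEM.IsBigOp μ (fun n ω => (n : ℝ) ^ (-(m : ℝ) / 2) *
            HEM.Tensor.frobenius (HEM.embTensor m (αh n ω) - HEM.embTensor m (αs n)))
            (fun n => √(ε n / s n))) := by
  refine ⟨1 / 16, by norm_num, ?_⟩
  intro Ω _ μ _ K s l₀ l₁ ε αs E αh _ hs h₀ h₁ hε hαs hE hαh hpen hlim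
  have htail := HEM.eventually_tail_le hm hr hc₀ hs h₀ h₁ hε hαs hE hαh hpen hlim
  have hbad := htail.mono fun n h => h.2
  set B : ℝ := m.factorial * m / HEM.hellingerConst (r * max 1 c₀ ^ m)
  have hB : 0 < B := by
    have := HEM.hellingerConst_pos (r * max 1 c₀ ^ m)
    have : 0 < (m : ℝ) := by exact_mod_cast (by lia : 0 < m)
    positivity
  have hedge : ∀ n, 1 ≤ n → ∀ ω, ¬ ε n ≤ HEM.avgHellingerSq (s n) (HEM.embTensor m (αh n ω))
      (HEM.embTensor m (αs n)) →
      (open Classical in ∑ i with HEM.IsEdgeIndex i,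
        (HEM.embTensor m (αh n ω) i - HEM.embTensor m (αs n) i) ^ 2) ≤
        B * (n : ℝ) ^ m * (ε n / s n) := by
    intro n hn ω hω
    refine (HEM.sum_isEdgeIndex_sq_le (by lia) hn (hs n).1 (hαh n ω).1 (hαs n)).trans ?_
    exact mul_le_mul_of_nonneg_left (div_le_div_of_nonneg_right (not_le.1 hω).le (hs n).1.le)
      (by positivity)
  refine ⟨?_, ?_, ?_, fun hO => ?_⟩
  · filter_upwards [htail] with n hn
    refine hn.1.trans ?_
    rw [show -(1 / 16) * (HEM.numEdges n m : ℝ) * ε n = -(HEM.numEdges n m * ε n / 16) by ring]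
    linarith [Real.exp_pos (-(HEM.numEdges n m * ε n / 16))]
  · refine HEM.isBigOp_of_eventually_bound hbad one_pos (.of_forall fun n ω hω => ?_)
    rw [abs_of_nonneg (HEM.avgHellingerSq_nonneg _ _ _), one_mul]
    exact (not_le.1 hω).le
  · refine HEM.isBigOp_of_eventually_bound hbad (Real.sqrt_pos.2 hB) ?_
    filter_upwards [eventually_ge_atTop 1] with n hn ω hω
    rw [HEM.frobenius_edgePart, abs_of_nonneg (by positivity)]
    exact HEM.rpow_mul_sqrt_le hn hB.le (hedge n hn ω hω)
  · obtain ⟨c, hc, hcO⟩ := hO.exists_pos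
    set B' : ℝ := m ^ 2 * 2 ^ m * (2 * (r * max 1 c₀ ^ m)) ^ 2
    have hB' : 0 ≤ B' := by positivity
    refine HEM.isBigOp_of_eventually_bound hbad (M := √(B + B' * c))
      (Real.sqrt_pos.2 (by positivity)) ?_
    filter_upwards [eventually_ge_atTop 1, hcO.bound] with n hn hcn ω hω
    have hy : 0 < ε n / s n := div_pos (hε n) (hs n).1
    rw [Real.norm_of_nonneg (by positivity), Real.norm_of_nonneg hy.le] at hcn
    rw [HEM.Tensor.frobenius, abs_of_nonneg (by positivity)]
    refine HEM.rpow_mul_sqrt_le hn (by positivity) ?_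
    classical
    rw [← Finset.sum_filter_add_sum_filter_not Finset.univ
      (fun i : Fin m → Fin (n + 1) => HEM.IsEdgeIndex i)]
    have h1 := hedge n hn ω hω
    have h2 := HEM.sum_not_isEdgeIndex_sq_le hm hn (hαh n ω).1 (hαs n)
    have h3 : B' * (n : ℝ) ^ m * (n : ℝ)⁻¹ ≤ B' * (n : ℝ) ^ m * (c * (ε n / s n)) := by gcongr
    have h4 := add_le_add h1 (h2.trans h3)
    simp only [Pi.sub_apply]
    calc _ ≤ _ := by convert h4
      _ = _ := by ring
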